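/- Let $\mathbb{S}^3\subseteq\mathbb{R}^4$ be the unit sphere with its round metric $g^\circ$, let $E_{\rm i},E_{\rm j},E_{\rm k}$ be the orthonormal frame of $\mathbb{S}^3$ given by left multiplication by the quaternions ${\rm i},{\rm j},{\rm k}$, i.e. $E_{\rm i}(x)=(-x^1,x^0,-x^3,x^2)$, $E_{\rm j}(x)=(-x^2,x^3,x^0,-x^1)$, $E_{\rm k}(x)=(-x^3,-x^2,x^1,x^0)$, let $\theta^{\rm i},\theta^{\rm j},\theta^{\rm k}$ be the dual coframe, and orient $\mathbb{S}^3$ so that its Riemannian volume form is $\mu=\theta^{\rm i}\wedge\theta^{\rm j}\wedge\theta^{\rm k}$. Let $\sigma^{\rm i}=\mu(E_{\rm i},\cdot,\cdot)$; equivalently, the Lorentz force $Y$ of the magnetic system $(g^\circ,\sigma^{\rm i})$, defined by $g^\circ(Y(v),w)=\sigma^{\rm i}(v,w)$, is $Y_x(v)=E_{\rm i}(x)\times v$. For a magnetic system $(g,\sigma)$ (a smooth Riemannian metric and a smooth closed $2$-form) on a manifold $M$ with universal covering $p\colon\widetilde M\to M$, the Mañé critical value is $$\mathbf{c}(g,\sigma)=\inf_{\theta}\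 \sup_{x\in\widetilde M}\|\theta_x\|\in[0,\infty],$$ where $\theta$ ranges over the smooth $1$-forms on $\widetilde M$ with ${\rm d}\theta=p^*\sigma$, the norm is that of $p^*g$, and the infimum is $+\infty$ if there is no such $\theta$. Then: 1. $\mathbf{c}(g^\circ,\sigma^{\rm i})=1/2$. 2. The smooth $1$-form $\theta^{\rm i}/2$ satisfies ${\rm d}(\theta^{\rm i}/2)=\sigma^{\rm i}$ and has norm $1/2$ at every point of $\mathbb{S}^3$. 3. For every $s\in(0,1/2)$ the great circle $\gamma(t)=(\cos(st),\sin(st),0,0)$ has least period $T=2\pi/s$, and its action satisfies $$A_s(\gamma)=\int_0^T\Big(\tfrac12\big(\|\dot\gamma(t)\|^2+s^2\big)-\tfrac12\theta^{\rm i}_{\gamma(t)}(\dot\gamma(t))\Big)\,{\rm d}t=(2s-1)\pi<0.$$ -/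

import Mathlib

open scoped Manifold ContDiff ENNReal InnerProductSpace

noncomputable section

section Forms

variable {E : Type*} [NormedAddCommGroup E] [NormedSpace ℝ E]
  {M : Type*} [TopologicalSpace M] [ChartedSpace E M]
  {N : Type*} [TopologicalSpace N] [ChartedSpace E N]

variable (E M) in
/-- A (not necessarily smooth) differential `k`-form on a manifold `M` modelled on `E`. -/
abbrev DiffForm (k : ℕ) : Type _ :=
  ∀ x : M, TangentSpace 𝓘(ℝ, E) x [⋀^Fin k]→L[ℝ] ℝ

/-- The pullback `p^* α` of a differential form along a map `p : N → M`. -/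
def DiffForm.pullback {k : ℕ} (p : N → M) (α : DiffForm E M k) : DiffForm E N k :=
  fun x => (α (p x)).compContinuousLinearMap (mfderiv 𝓘(ℝ, E) 𝓘(ℝ, E) p x)

/-- The expression of the form `α` in the preferred chart at `x`: the pullback of `α` along the
inverse of that chart. It is meaningful on the target of the chart. -/
def DiffForm.inChart {k : ℕ} (α : DiffForm E M k) (x : M) : E → E [⋀^Fin k]→L[ℝ] ℝ :=
  fun y => (α ((extChartAt 𝓘(ℝ, E) x).symm y)).compContinuousLinearMap
    (mfderiv 𝓘(ℝ, E) 𝓘(ℝ, E) (extChartAt 𝓘(ℝ, E) x).symm y)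

/-- A differential form is smooth if its expression in each chart is. -/
def DiffForm.IsSmooth {k : ℕ} (α : DiffForm E M k) : Prop :=
  ∀ x : M, ContDiffOn ℝ ∞ (α.inChart x) (extChartAt 𝓘(ℝ, E) x).target

/-- The exterior derivative `dα`, computed at each point in the preferred chart there. -/
def DiffForm.d {k : ℕ} (α : DiffForm E M k) : DiffForm E M (k + 1) :=
  fun x => (extDeriv (α.inChart x) (extChartAt 𝓘(ℝ, E) x x)).compContinuousLinearMap
    (mfderiv 𝓘(ℝ, E) 𝓘(ℝ, E) (extChartAt 𝓘(ℝ, E) x) x)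

variable (E M) in
/-- A magnetic system: a smooth Riemannian metric together with a smooth closed `2`-form. -/
structure MagneticSystem [IsManifold 𝓘(ℝ, E) ∞ M] where
  /-- the Riemannian metric -/
  metric : Bundle.ContMDiffRiemannianMetric 𝓘(ℝ, E) ∞ E
    (fun x : M => TangentSpace 𝓘(ℝ, E) x)
  /-- the magnetic form -/
  form : DiffForm E M 2
  smooth : form.IsSmooth
  closed : form.d = 0

variable (E) in
/-- `p : N → M` is a universal covering of the smooth manifold `M` by the smooth manifold `N`. -/
structure IsUniversalCovering (p : N → M) : Prop where
  simplyConnected : SimplyConnectedSpace N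
  surjective : Function.Surjective p
  isCoveringMap : IsCoveringMap p
  isLocalDiffeomorph : IsLocalDiffeomorph 𝓘(ℝ, E) 𝓘(ℝ, E) ∞ p

/-- The norm `‖θ_x‖` of the `1`-form `θ` on `N` at `x`, with respect to the pullback metric
`p^* g`: the supremum of `|θ_x(v)|` over all tangent vectors `v` with `‖v‖ ≤ 1`. -/
def formNorm [IsManifold 𝓘(ℝ, E) ∞ M]
    (g : Bundle.ContMDiffRiemannianMetric 𝓘(ℝ, E) ∞ E (fun x : M => TangentSpace 𝓘(ℝ, E) x))
    (p : N → M) (θ : DiffForm E N 1) (x : N) : ℝ≥0∞ :=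
  ⨆ (v : TangentSpace 𝓘(ℝ, E) x)
    (_ : g.inner (p x) (mfderiv 𝓘(ℝ, E) 𝓘(ℝ, E) p x v) (mfderiv 𝓘(ℝ, E) 𝓘(ℝ, E) p x v) ≤ 1),
    ENNReal.ofReal |θ x (fun _ => v)|

/-- The Mañé critical value of a magnetic system `(g, σ)` on `M`, computed on a universal covering
`p : N → M`: the infimum of `sup_x ‖θ_x‖` over all smooth `1`-forms `θ` on `N` such that
`p^* σ = dθ`. The infimum is `∞` if there is no such `θ`, that is, if `σ` is not weakly exact. -/
def maneCriticalValue [IsManifold 𝓘(ℝ, E) ∞ M] (S : MagneticSystem E M) (p : N → M) : ℝ≥0∞ :=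
  ⨅ (θ : DiffForm E N 1) (_ : θ.IsSmooth ∧ S.form.pullback p = θ.d),
    ⨆ x : N, formNorm S.metric p θ x

/-- The action `A_s(γ) = ∫_0^T (‖γ'‖² + s²) / 2 - θ(γ') dt` of a curve `γ` in `M` defined on
`[0, T]`, for a Riemannian metric `g` and a `1`-form `θ` on `M`. -/
def magneticAction [IsManifold 𝓘(ℝ, E) ∞ M]
    (g : Bundle.ContMDiffRiemannianMetric 𝓘(ℝ, E) ∞ E (fun x : M => TangentSpace 𝓘(ℝ, E) x))
    (θ : DiffForm E M 1) (s T : ℝ) (γ : ℝ → M) : ℝ :=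
  ∫ t in (0 : ℝ)..T,
    ((g.inner (γ t) (mfderiv 𝓘(ℝ, ℝ) 𝓘(ℝ, E) γ t (1 : ℝ)) (mfderiv 𝓘(ℝ, ℝ) 𝓘(ℝ, E) γ t (1 : ℝ))
        + s ^ 2) / 2
      - θ (γ t) (fun _ => mfderiv 𝓘(ℝ, ℝ) 𝓘(ℝ, E) γ t (1 : ℝ)))

end Forms

section Sphere

/-- Euclidean space `ℝ⁴`, that is, the quaternions. -/
abbrev R4 : Type := EuclideanSpace ℝ (Fin 4)

/-- The unit sphere `S³` in `ℝ⁴`. -/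
abbrev S3 : Type := Metric.sphere (0 : EuclideanSpace ℝ (Fin 4)) 1

/-- The differential of the inclusion of `S³` in `ℝ⁴`. -/
def dIncl (x : S3) : TangentSpace (𝓡 3) x →L[ℝ] R4 :=
  mvfderiv (𝓡 3) (fun y : S3 => (y : R4)) x

/-- The vector fields on `ℝ⁴` given by left multiplication by the quaternions `i`, `j`, `k`
(for the indices `0`, `1`, `2`). -/
def quatField (a : Fin 3) (x : R4) : R4 :=
  match a with
  | 0 => !₂[-x 1, x 0, -x 3, x 2]
  | 1 => !₂[-x 2, x 3, x 0, -x 1]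
  | 2 => !₂[-x 3, -x 2, x 1, x 0]

theorem inner_R4 (u v : R4) :
    ⟪u, v⟫_ℝ = u 0 * v 0 + u 1 * v 1 + u 2 * v 2 + u 3 * v 3 := by
  simp [PiLp.inner_apply, Fin.sum_univ_four]; ring

theorem dIncl_injective (x : S3) : Function.Injective (dIncl x) := by
  have := Fact.mk (@finrank_euclideanSpace_fin ℝ _ (3 + 1))
  exact injective_mvfderiv_subtypeVal_sphere (n := 3) x

theorem exists_dIncl_eq (x : S3) (w : R4) (hw : ⟪(x : R4), w⟫_ℝ = 0) :
    ∃ v : TangentSpace (𝓡 3) x, dIncl x v = w := by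
  have := Fact.mk (@finrank_euclideanSpace_fin ℝ _ (3 + 1))
  have h : w ∈ (mvfderiv (𝓡 3) (fun y : S3 => (y : R4)) x).range := by
    rw [range_mvfderiv_subtypeVal (n := 3) x]
    exact Submodule.mem_orthogonal_singleton_iff_inner_right.2 hw
  exact h

theorem inner_dIncl (x : S3) (v : TangentSpace (𝓡 3) x) : ⟪(x : R4), dIncl x v⟫_ℝ = 0 := by
  have := Fact.mk (@finrank_euclideanSpace_fin ℝ _ (3 + 1))
  have h : dIncl x v ∈ (mvfderiv (𝓡 3) (fun y : S3 => (y : R4)) x).range := ⟨v, rfl⟩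
  rw [range_mvfderiv_subtypeVal (n := 3) x] at h
  exact Submodule.mem_orthogonal_singleton_iff_inner_right.1 h

theorem inner_quatField (a : Fin 3) (x : R4) : ⟪x, quatField a x⟫_ℝ = 0 := by
  fin_cases a <;> simp [inner_R4, quatField] <;> ring

/-- The vector fields `E_i`, `E_j`, `E_k` on `S³`. -/
def killingField (a : Fin 3) (x : S3) : TangentSpace (𝓡 3) x :=
  Classical.choose (exists_dIncl_eq x (quatField a x) (inner_quatField a x))

theorem dIncl_killingField (a : Fin 3) (x : S3) :
    dIncl x (killingField a x) = quatField a x :=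
  Classical.choose_spec (exists_dIncl_eq x (quatField a x) (inner_quatField a x))

/-- The coframe `θ^i`, `θ^j`, `θ^k` on `S³` dual to the orthonormal frame `E_i`, `E_j`, `E_k`. -/
def coframe (a : Fin 3) : DiffForm (EuclideanSpace ℝ (Fin 3)) S3 1 := fun x =>
  ContinuousAlternatingMap.ofSubsingleton ℝ (TangentSpace (𝓡 3) x) ℝ (0 : Fin 1)
    ((innerSL ℝ (quatField a x)).comp (dIncl x))

/-- The Riemannian volume form `θ^i ∧ θ^j ∧ θ^k` of `S³`. -/
def volumeForm : DiffForm (EuclideanSpace ℝ (Fin 3)) S3 3 := fun x =>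
  { Matrix.detRowAlternating.compLinearMap
      (LinearMap.pi fun a : Fin 3 =>
        (((innerSL ℝ (quatField a x)).comp (dIncl x) : TangentSpace (𝓡 3) x →L[ℝ] ℝ) :
          TangentSpace (𝓡 3) x →ₗ[ℝ] ℝ)) with
    cont := by
      change Continuous fun v : Fin 3 → TangentSpace (𝓡 3) x =>
        Matrix.det (Matrix.of fun b a : Fin 3 =>
          ((innerSL ℝ (quatField a x)).comp (dIncl x)) (v b))
      refine Continuous.matrix_det (continuous_matrix fun b a => ?_)
      exact ((innerSL ℝ (quatField a x)).comp (dIncl x)).continuous.comp (continuous_apply b) }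

/-- The magnetic form `σ^i = μ(E_i, ·, ·)`. -/
def killingMagneticForm : DiffForm (EuclideanSpace ℝ (Fin 3)) S3 2 := fun x =>
  { (volumeForm x).toAlternatingMap.curryLeft (killingField 0 x) with
    cont := (volumeForm x).cont.comp
      (continuous_const.matrixVecCons continuous_id :
        Continuous fun v : Fin 2 → TangentSpace (𝓡 3) x =>
          Matrix.vecCons (killingField 0 x) v) }

theorem volumeForm_apply (x : S3) (v : Fin 3 → TangentSpace (𝓡 3) x) :
    volumeForm x v = Matrix.det (Matrix.of fun b a : Fin 3 => ⟪quatField a x, dIncl x (v b)⟫_ℝ) :=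
  rfl

/-- The constant `2`-form on `ℝ⁴` given by `(u, v) ↦ ⟪i u, v⟫`. -/
def ambientForm : R4 [⋀^Fin 2]→L[ℝ] ℝ :=
  { toFun := fun v => ⟪quatField 0 (v 0), v 1⟫_ℝ
    map_update_add' := by
      intro _ m i u v
      fin_cases i <;> simp [inner_R4, quatField] <;> ring
    map_update_smul' := by
      intro _ m i c v
      fin_cases i <;> simp [inner_R4, quatField] <;> ring
    map_eq_zero_of_eq' := by
      intro v i j h hij
      have h01 : v 0 = v 1 := by fin_cases i <;> fin_cases j <;> simp_all
      simp [inner_R4, quatField, h01]; ring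
    cont := by
      simp only [inner_R4, quatField]
      simp
      fun_prop }

theorem killingMagneticForm_eq (x : S3) :
    killingMagneticForm x = ambientForm.compContinuousLinearMap (dIncl x) := by
  ext v
  have h0 := inner_dIncl x (v 0)
  have h1 := inner_dIncl x (v 1)
  have hx : (x : R4) 0 ^ 2 + (x : R4) 1 ^ 2 + (x : R4) 2 ^ 2 + (x : R4) 3 ^ 2 = 1 := by
    have h := real_inner_self_eq_norm_sq (x : R4)
    rw [norm_eq_of_mem_sphere, inner_R4] at h
    linarith
  change volumeForm x (Matrix.vecCons (killingField 0 x) v) =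
    ⟪quatField 0 (dIncl x (v 0)), dIncl x (v 1)⟫_ℝ
  have h2 : Matrix.vecCons (killingField 0 x) v 2 = v 1 := rfl
  rw [volumeForm_apply, Matrix.det_fin_three]
  simp only [Matrix.of_apply, Matrix.cons_val_zero, Matrix.cons_val_one, h2, dIncl_killingField]
  change ⟪(x : R4), dIncl x (v 0)⟫_ℝ = 0 at h0
  generalize dIncl x (v 0) = p at *
  generalize dIncl x (v 1) = q at *
  generalize (x : R4) = y at *
  simp only [inner_R4, quatField] at *
  simp only [Matrix.cons_val] at *
  generalize y 0 = y0, y 1 = y1, y 2 = y2, y 3 = y3 at *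
  generalize p 0 = p0, p 1 = p1, p 2 = p2, p 3 = p3 at *
  generalize q 0 = q0, q 1 = q1, q 2 = q2, q 3 = q3 at *
  linear_combination
    (y0 ^ 2 + y1 ^ 2 + y2 ^ 2 + y3 ^ 2 + 1) * (-p1 * q0 + p0 * q1 - p3 * q2 + p2 * q3) * hx
      - (y0 ^ 2 + y1 ^ 2 + y2 ^ 2 + y3 ^ 2) * (-y1 * q0 + y0 * q1 - y3 * q2 + y2 * q3) * h0
      + (y0 ^ 2 + y1 ^ 2 + y2 ^ 2 + y3 ^ 2) * (-y1 * p0 + y0 * p1 - y3 * p2 + y2 * p3) * h1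

/-- The inverse of the preferred chart at `x`, as a parametrization with values in `ℝ⁴`. -/
def paramS3 (x : S3) (y : EuclideanSpace ℝ (Fin 3)) : R4 :=
  ((extChartAt (𝓡 3) x).symm y : S3)

theorem contMDiff_inclS3 : ContMDiff (𝓡 3) 𝓘(ℝ, R4) ∞ (fun y : S3 => (y : R4)) := by
  have := Fact.mk (@finrank_euclideanSpace_fin ℝ _ (3 + 1))
  exact contMDiff_coe_sphere (n := 3)

theorem contDiffOn_paramS3 (x : S3) :
    ContDiffOn ℝ ∞ (paramS3 x) (extChartAt (𝓡 3) x).target := by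
  rw [← contMDiffOn_iff_contDiffOn]
  exact contMDiff_inclS3.comp_contMDiffOn (contMDiffOn_extChartAt_symm x)

theorem fderiv_paramS3 (x : S3) {y : EuclideanSpace ℝ (Fin 3)}
    (hy : y ∈ (extChartAt (𝓡 3) x).target) :
    fderiv ℝ (paramS3 x) y = (dIncl ((extChartAt (𝓡 3) x).symm y)).comp
      (mfderiv 𝓘(ℝ, EuclideanSpace ℝ (Fin 3)) (𝓡 3) (extChartAt (𝓡 3) x).symm y) := by
  rw [← mfderiv_eq_fderiv]
  have h1 : MDifferentiableAt 𝓘(ℝ, EuclideanSpace ℝ (Fin 3)) (𝓡 3)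
      (extChartAt (𝓡 3) x).symm y :=
    ((contMDiffOn_extChartAt_symm (n := ∞) x).contMDiffAt
      ((isOpen_extChartAt_target x).mem_nhds hy)).mdifferentiableAt (by simp)
  exact mfderiv_comp y (contMDiff_inclS3.mdifferentiableAt (by simp)) h1

theorem inChart_killingMagneticForm (x : S3) {y : EuclideanSpace ℝ (Fin 3)}
    (hy : y ∈ (extChartAt (𝓡 3) x).target) :
    DiffForm.inChart killingMagneticForm x y =
      ambientForm.compContinuousLinearMap (fderiv ℝ (paramS3 x) y) := by
  rw [fderiv_paramS3 x hy]
  unfold DiffForm.inChart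
  rw [killingMagneticForm_eq]
  rfl

theorem contDiff_ambientForm_comp : ContDiff ℝ ∞
    fun f : EuclideanSpace ℝ (Fin 3) →L[ℝ] R4 => ambientForm.compContinuousLinearMap f := by
  let B : R4 →L[ℝ] R4 →L[ℝ] ℝ :=
    ((ContinuousAlternatingMap.ofSubsingletonLIE (𝕜 := ℝ) (E := R4) (F := ℝ) (0 : Fin 1)).symm :
      (R4 [⋀^Fin 1]→L[ℝ] ℝ) →L[ℝ] (R4 →L[ℝ] ℝ)).comp ambientForm.curryLeft
  let C := (ContinuousAlternatingMap.ofSubsingletonLIE (𝕜 := ℝ) (E := EuclideanSpace ℝ (Fin 3)) (F := ℝ) (0 : Fin 1)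
    : (EuclideanSpace ℝ (Fin 3) →L[ℝ] ℝ) →L[ℝ] (EuclideanSpace ℝ (Fin 3) [⋀^Fin 1]→L[ℝ] ℝ))
  let L := ContinuousLinearMap.compL ℝ (EuclideanSpace ℝ (Fin 3)) R4 ℝ
  have h : (fun f : EuclideanSpace ℝ (Fin 3) →L[ℝ] R4 => ambientForm.compContinuousLinearMap f) =
      fun f => (1 / 2 : ℝ) • ContinuousAlternatingMap.alternatizeUncurryFinCLM ℝ
        (EuclideanSpace ℝ (Fin 3)) ℝ (C.comp ((L.flip f).comp (B.comp f))) := by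
    funext f
    ext v
    have e (p q : EuclideanSpace ℝ (Fin 3)) :
        (C.comp ((L.flip f).comp (B.comp f))) p (fun _ => q) = ⟪quatField 0 (f p), f q⟫_ℝ := rfl
    change ⟪quatField 0 (f (v 0)), f (v 1)⟫_ℝ = (1 / 2 : ℝ) *
      ContinuousAlternatingMap.alternatizeUncurryFin (C.comp ((L.flip f).comp (B.comp f))) v
    rw [ContinuousAlternatingMap.alternatizeUncurryFin_apply, Fin.sum_univ_two]
    have r0 : Fin.removeNth 0 v = fun _ => v 1 := by ext i; fin_cases i; rfl
    have r1 : Fin.removeNth 1 v = fun _ => v 0 := by ext i; fin_cases i; rfl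
    rw [r0, r1, e, e]
    simp [inner_R4, quatField]
    ring
  rw [h]
  fun_prop

theorem killingMagneticForm_smooth : DiffForm.IsSmooth killingMagneticForm := by
  intro x
  refine ContDiffOn.congr ?_ fun y hy => inChart_killingMagneticForm x hy
  exact contDiff_ambientForm_comp.comp_contDiffOn
    ((contDiffOn_paramS3 x).fderiv_of_isOpen (isOpen_extChartAt_target x) (by simp))

theorem killingMagneticForm_closed : DiffForm.d killingMagneticForm = 0 := by
  funext x
  have hx : (extChartAt (𝓡 3) x) x ∈ (extChartAt (𝓡 3) x).target := mem_extChartAt_target x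
  have hn := (isOpen_extChartAt_target (I := 𝓡 3) x).mem_nhds hx
  have h : extDeriv (DiffForm.inChart killingMagneticForm x) ((extChartAt (𝓡 3) x) x) = 0 := by
    have he : DiffForm.inChart killingMagneticForm x =ᶠ[nhds ((extChartAt (𝓡 3) x) x)]
        fun y => ambientForm.compContinuousLinearMap (fderiv ℝ (paramS3 x) y) := by
      filter_upwards [hn] with y hy using inChart_killingMagneticForm x hy
    rw [he.extDeriv_eq]
    have := extDeriv_pullback (x := (extChartAt (𝓡 3) x) x) (f := paramS3 x)
      (differentiableAt_const ambientForm) ((contDiffOn_paramS3 x).contDiffAt hn) (r := ∞)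
      (by simp; exact WithTop.coe_le_coe.2 le_top)
    rw [this]
    have h0 : extDeriv (fun _ : R4 => ambientForm) (paramS3 x ((extChartAt (𝓡 3) x) x)) = 0 := by
      simp only [extDeriv, fderiv_fun_const, Pi.zero_apply]
      exact (ContinuousAlternatingMap.alternatizeUncurryFinCLM ℝ R4 ℝ (n := 2)).map_zero
    rw [h0]
    rfl
  unfold DiffForm.d
  rw [h]
  rfl

/-- The Euclidean inner product of `ℝ⁴` restricted to the tangent space of `S³` at `x`. -/
def roundInner (x : S3) : TangentSpace (𝓡 3) x →L[ℝ] TangentSpace (𝓡 3) x →L[ℝ] ℝ :=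
  let A : EuclideanSpace ℝ (Fin 3) →L[ℝ] R4 := dIncl x
  (innerSL ℝ : R4 →L[ℝ] R4 →L[ℝ] ℝ).bilinearComp A A

theorem roundInner_apply (x : S3) (v w : TangentSpace (𝓡 3) x) :
    roundInner x v w = ⟪dIncl x v, dIncl x w⟫_ℝ :=
  rfl

/-- The round metric on `S³`. -/
def roundMetric : Bundle.ContMDiffRiemannianMetric (𝓡 3) ∞ (EuclideanSpace ℝ (Fin 3))
    (fun x : S3 => TangentSpace (𝓡 3) x) where
  inner := roundInner
  symm x v w := real_inner_comm (dIncl x w) (dIncl x v)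
  pos x v hv := by
    have : dIncl x v ≠ 0 := fun h => hv (dIncl_injective x (by rw [h, map_zero]))
    exact real_inner_self_pos.2 this
  isVonNBounded x := by
    let A : EuclideanSpace ℝ (Fin 3) →L[ℝ] R4 := dIncl x
    obtain ⟨K, -, hK⟩ := (A : EuclideanSpace ℝ (Fin 3) →ₗ[ℝ] R4).exists_antilipschitzWith
      (LinearMap.ker_eq_bot.2 (dIncl_injective x))
    have h : Bornology.IsVonNBounded ℝ {v : EuclideanSpace ℝ (Fin 3) | ⟪A v, A v⟫_ℝ < 1} := by
      rw [NormedSpace.isVonNBounded_iff]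
      refine (Metric.isBounded_closedBall (x := (0 : EuclideanSpace ℝ (Fin 3)))
        (r := K)).subset fun v hv => ?_
      have h1 : ‖A v‖ ≤ 1 := by
        have hv' : ⟪A v, A v⟫_ℝ < 1 := hv
        rw [real_inner_self_eq_norm_sq] at hv'
        nlinarith [norm_nonneg (A v)]
      have h2 := hK.le_mul_dist v 0
      simp only [map_zero, dist_zero_right] at h2
      rw [mem_closedBall_zero_iff]
      exact h2.trans (mul_le_of_le_one_right K.2 h1)
    exact h
  contMDiff := by
    intro x₀
    rw [Bundle.contMDiffAt_section]
    have h1 := (contMDiff_inclS3 x₀).mfderiv_const (m := ∞) (by simp)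
    have h2 : ContDiff ℝ ∞ fun A : EuclideanSpace ℝ (Fin 3) →L[ℝ] R4 =>
        (innerSL ℝ : R4 →L[ℝ] R4 →L[ℝ] ℝ).bilinearComp A A := by
      have h : (fun A : EuclideanSpace ℝ (Fin 3) →L[ℝ] R4 =>
          (innerSL ℝ : R4 →L[ℝ] R4 →L[ℝ] ℝ).bilinearComp A A) = fun A =>
          ((ContinuousLinearMap.compL ℝ (EuclideanSpace ℝ (Fin 3)) R4 ℝ).flip A).comp
            ((innerSL ℝ : R4 →L[ℝ] R4 →L[ℝ] ℝ).comp A) := by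
        funext A
        ext v w
        rfl
      rw [h]
      fun_prop
    refine (h2.contMDiff.contMDiffAt.comp x₀ h1).congr_of_eventuallyEq ?_
    filter_upwards [(chartAt (EuclideanSpace ℝ (Fin 3)) x₀).open_source.mem_nhds
      (mem_chart_source _ x₀)] with x hx
    rw [hom_trivializationAt_apply]
    ext v w
    have hb : x ∈ (trivializationAt (EuclideanSpace ℝ (Fin 3))
        (fun y : S3 => TangentSpace (𝓡 3) y) x₀).baseSet := by
      rw [TangentBundle.trivializationAt_baseSet]
      exact hx
    have key (u : EuclideanSpace ℝ (Fin 3)) :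
        dIncl x ((trivializationAt (EuclideanSpace ℝ (Fin 3))
          (fun y : S3 => TangentSpace (𝓡 3) y) x₀).symm x u) =
        inTangentCoordinates (𝓡 3) 𝓘(ℝ, R4) id (fun y : S3 => (y : R4))
          (fun y : S3 => mfderiv (𝓡 3) 𝓘(ℝ, R4) (fun y : S3 => (y : R4)) y) x₀ x u := by
      rw [← Bundle.Trivialization.symmL_apply (R := ℝ) _ hb]
      unfold inTangentCoordinates ContinuousLinearMap.inCoordinates
      rw [TangentBundle.continuousLinearMapAt_model_space]
      rfl
    refine (inCoordinates_apply_eq₂ (E₃ := Bundle.Trivial S3 ℝ) hb hb (Set.mem_univ x)).trans ?_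
    have triv (r : ℝ) : Bundle.Trivialization.linearMapAt ℝ
        (trivializationAt ℝ (Bundle.Trivial S3 ℝ) x₀) x r = r := by
      simp
    refine (triv _).trans ?_
    exact congrArg₂ (fun a b : R4 => ⟪a, b⟫_ℝ) (key v) (key w)

/-- The Killing magnetic system `(g°, σ^i)` on `S³`. -/
def killingSystem : MagneticSystem (EuclideanSpace ℝ (Fin 3)) S3 where
  metric := roundMetric
  form := killingMagneticForm
  smooth := killingMagneticForm_smooth
  closed := killingMagneticForm_closed

/-- The great circle `t ↦ (cos(st), sin(st), 0, 0)` on `S³`. -/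
def hopfCircle (s t : ℝ) : S3 :=
  ⟨!₂[Real.cos (s * t), Real.sin (s * t), 0, 0], by
    simp [EuclideanSpace.norm_eq, Fin.sum_univ_four]⟩

end Sphere
end

/-! The sphere is handled through the ambient space: `paramS3` pulls the linear primitive
`ambientPrimitive` of the constant form `ambientForm` back to `θ^i / 2`, so naturality of the
exterior derivative gives `d(θ^i / 2) = σ^i`. By Cauchy-Schwarz `θ^i / 2` has norm `1/2`, attained
on `E_i`. Its pullback to any universal covering is an admissible primitive, whence the critical
value is at most `1/2`.

For the lower bound, let `θ` be any admissible primitive upstairs. An inverse stereographic chart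
parametrizes a region of the sphere containing a unit-speed Hopf circle, and this parametrization
lifts to a smooth map `F` into the covering space. On the model space the pullbacks of `θ` and `θ^i
/ 2` have the same differential, so they differ by some `df`. Along the closed circle `f` returns to
its initial value, and Rolle's theorem gives a time at which both forms agree on the velocity. There
`θ^i / 2` equals `1/2` on a unit vector, so `θ` has norm at least `1/2` (`exists_eq_on_velocity`,
`half_le_formNorm_of_lift`). Lifting a chart avoids identifying the covering space with the sphere.
-/

noncomputable section

/-! ### Naturality of forms and exterior derivatives under pullback -/

section Pullback

open Filter Topology

variable {E : Type*} [NormedAddCommGroup E] [NormedSpace ℝ E]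
  {M : Type*} [TopologicalSpace M] [ChartedSpace E M]
  {N : Type*} [TopologicalSpace N] [ChartedSpace E N]

/-- The pullback of a form along a map from the model space, as a form on a vector space. -/
def DiffForm.pullbackModel {k : ℕ} (φ : E → M) (α : DiffForm E M k) : E → E [⋀^Fin k]→L[ℝ] ℝ :=
  α.pullback φ

theorem ContMDiffAt.contDiffAt_extChartAt_comp [IsManifold 𝓘(ℝ, E) ∞ M] {φ : E → M} {y : E}
    (hφ : ContMDiffAt 𝓘(ℝ, E) 𝓘(ℝ, E) ∞ φ y) :
    ContDiffAt ℝ ∞ (extChartAt 𝓘(ℝ, E) (φ y) ∘ φ) y :=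
  ((contMDiffAt_extChartAt (n := ∞)).comp y hφ).contDiffAt

/-- The pullback of a form to the model space, expressed through a chart. -/
theorem DiffForm.pullback_eventuallyEq [IsManifold 𝓘(ℝ, E) ∞ M] {k : ℕ} (α : DiffForm E M k) {φ : E → M} {y : E}
    (hφ : ContMDiffAt 𝓘(ℝ, E) 𝓘(ℝ, E) ∞ φ y) :
    α.pullbackModel φ =ᶠ[𝓝 y] fun z =>
      (α.inChart (φ y) (extChartAt 𝓘(ℝ, E) (φ y) (φ z))).compContinuousLinearMap
        (fderiv ℝ (extChartAt 𝓘(ℝ, E) (φ y) ∘ φ) z) := by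
  have : IsManifold 𝓘(ℝ, E) 1 M := .of_le (n := ∞) (by exact_mod_cast le_top)
  -- Regularity at a point spreads to a neighbourhood only at orders other than `∞`, so the order is
  -- lowered to 1.
  have h1 : ContMDiffAt 𝓘(ℝ, E) 𝓘(ℝ, E) 1 φ y := hφ.of_le (by exact_mod_cast le_top)
  filter_upwards [(contMDiffAt_iff_contMDiffAt_nhds (by simp)).1 h1,
    hφ.continuousAt (extChartAt_source_mem_nhds (I := 𝓘(ℝ, E)) (φ y))] with z hz' hs
  have hz := hz'.mdifferentiableAt one_ne_zero
  have hc : MDifferentiableAt 𝓘(ℝ, E) 𝓘(ℝ, E) (extChartAt 𝓘(ℝ, E) (φ y)) (φ z) :=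
    mdifferentiableAt_extChartAt (by simpa using hs)
  have h1 : fderiv ℝ (extChartAt 𝓘(ℝ, E) (φ y) ∘ φ) z =
      (mfderiv 𝓘(ℝ, E) 𝓘(ℝ, E) (extChartAt 𝓘(ℝ, E) (φ y)) (φ z)).comp
        (mfderiv 𝓘(ℝ, E) 𝓘(ℝ, E) φ z) := by
    rw [← mfderiv_eq_fderiv]
    exact mfderiv_comp z hc hz
  have h2 := mfderivWithin_extChartAt_symm_comp_mfderiv_extChartAt' (I := 𝓘(ℝ, E)) hs
  rw [ModelWithCorners.range_eq_univ, mfderivWithin_univ] at h2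
  have h3 : (extChartAt 𝓘(ℝ, E) (φ y)).symm (extChartAt 𝓘(ℝ, E) (φ y) (φ z)) = φ z :=
    (extChartAt 𝓘(ℝ, E) (φ y)).left_inv hs
  rw [h1]
  ext v
  unfold DiffForm.pullbackModel DiffForm.pullback DiffForm.inChart
  change α (φ z) _ = α _ _
  have key (u : E) : mfderiv 𝓘(ℝ, E) 𝓘(ℝ, E) (extChartAt 𝓘(ℝ, E) (φ y)).symm
      (extChartAt 𝓘(ℝ, E) (φ y) (φ z)) (mfderiv 𝓘(ℝ, E) 𝓘(ℝ, E) (extChartAt 𝓘(ℝ, E) (φ y)) (φ z)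
        u) = u := DFunLike.congr_fun h2 u
  -- The base points are equal only propositionally, but every tangent space is definitionally `E`,
  -- so `α` can be transported on fixed vectors.
  have e (w : M) (hw : w = φ z) (f : Fin k → E) : α w f = α (φ z) f := by subst hw; rfl
  refine (e _ rfl _).trans (Eq.trans ?_ (e _ h3 _).symm)
  congr 1
  funext i
  exact (key _).symm

/-- A 1-form is a linear functional, and under this identification pullback becomes composition of
continuous linear maps, which is jointly smooth. -/
theorem ContDiffAt.compContinuousLinearMap_one {F G : Type*} [NormedAddCommGroup F]
    [NormedSpace ℝ F] [NormedAddCommGroup G] [NormedSpace ℝ G] {n : WithTop ℕ∞}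
    {β : G → F [⋀^Fin 1]→L[ℝ] ℝ} {A : G → E →L[ℝ] F} {y : G} (hβ : ContDiffAt ℝ n β y)
    (hA : ContDiffAt ℝ n A y) :
    ContDiffAt ℝ n (fun z => (β z).compContinuousLinearMap (A z)) y := by
  let C := (ContinuousAlternatingMap.ofSubsingletonLIE (𝕜 := ℝ) (E := E) (F := ℝ) (0 : Fin 1)
    : (E →L[ℝ] ℝ) →L[ℝ] (E [⋀^Fin 1]→L[ℝ] ℝ))
  let D := ((ContinuousAlternatingMap.ofSubsingletonLIE (𝕜 := ℝ) (E := F) (F := ℝ)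
    (0 : Fin 1)).symm : (F [⋀^Fin 1]→L[ℝ] ℝ) →L[ℝ] (F →L[ℝ] ℝ))
  have h : (fun z => (β z).compContinuousLinearMap (A z)) = fun z => C ((D (β z)).comp (A z)) := by
    funext z
    ext v
    change β z _ = β z _
    congr 1
    funext i
    fin_cases i
    rfl
  rw [h]
  exact C.contDiff.contDiffAt.comp y ((D.contDiff.contDiffAt.comp y hβ).clm_comp hA)

theorem DiffForm.IsSmooth.contDiffAt_inChart {k : ℕ} {α : DiffForm E M k} (hα : α.IsSmooth)
    (x : M) : ContDiffAt ℝ ∞ (α.inChart x) (extChartAt 𝓘(ℝ, E) x x) :=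
  (hα x).contDiffAt ((isOpen_extChartAt_target x).mem_nhds (mem_extChartAt_target x))

theorem DiffForm.IsSmooth.contDiffAt_pullback [IsManifold 𝓘(ℝ, E) ∞ M] {α : DiffForm E M 1} (hα : α.IsSmooth) {φ : E → M}
    {y : E} (hφ : ContMDiffAt 𝓘(ℝ, E) 𝓘(ℝ, E) ∞ φ y) :
    ContDiffAt ℝ ∞ (α.pullbackModel φ) y := by
  refine ContDiffAt.congr_of_eventuallyEq ?_ (α.pullback_eventuallyEq hφ)
  have hψ := hφ.contDiffAt_extChartAt_comp
  have h : ContDiffAt ℝ ∞ (fun z => α.inChart (φ y) (extChartAt 𝓘(ℝ, E) (φ y) (φ z))) y :=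
    ContDiffAt.comp (g := α.inChart (φ y)) y (hα.contDiffAt_inChart (φ y)) hψ
  exact ContDiffAt.compContinuousLinearMap_one h
    (hψ.fderiv_right (by simp))

/-- The exterior derivative commutes with pullbacks to the model space. -/
theorem DiffForm.IsSmooth.extDeriv_pullback [IsManifold 𝓘(ℝ, E) ∞ M] {k : ℕ} {α : DiffForm E M k} (hα : α.IsSmooth)
    {φ : E → M} {y : E} (hφ : ContMDiffAt 𝓘(ℝ, E) 𝓘(ℝ, E) ∞ φ y) :
    extDeriv (α.pullbackModel φ) y = α.d.pullbackModel φ y := by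
  have hψ := hφ.contDiffAt_extChartAt_comp
  have h1 : fderiv ℝ (extChartAt 𝓘(ℝ, E) (φ y) ∘ φ) y =
      (mfderiv 𝓘(ℝ, E) 𝓘(ℝ, E) (extChartAt 𝓘(ℝ, E) (φ y)) (φ y)).comp
        (mfderiv 𝓘(ℝ, E) 𝓘(ℝ, E) φ y) := by
    rw [← mfderiv_eq_fderiv]
    have : IsManifold 𝓘(ℝ, E) 1 M := .of_le (n := ∞) (by exact_mod_cast le_top)
    exact mfderiv_comp y (mdifferentiableAt_extChartAt (mem_chart_source _ _))
      (hφ.mdifferentiableAt (by simp))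
  rw [(α.pullback_eventuallyEq hφ).extDeriv_eq]
  have := _root_.extDeriv_pullback (x := y) (f := extChartAt 𝓘(ℝ, E) (φ y) ∘ φ) (r := ∞)
    ((hα.contDiffAt_inChart (φ y)).differentiableAt (by simp)) hψ
    (by simp; exact WithTop.coe_le_coe.2 le_top)
  refine this.trans ?_
  rw [h1]
  rfl

variable [IsManifold 𝓘(ℝ, E) ∞ N]

theorem contMDiffAt_comp_extChartAt_symm {p : N → M} (hp : ContMDiff 𝓘(ℝ, E) 𝓘(ℝ, E) ∞ p)
    (x : N) {y : E} (hy : y ∈ (extChartAt 𝓘(ℝ, E) x).target) :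
    ContMDiffAt 𝓘(ℝ, E) 𝓘(ℝ, E) ∞ (p ∘ (extChartAt 𝓘(ℝ, E) x).symm) y :=
  hp.contMDiffAt.comp y ((contMDiffOn_extChartAt_symm x).contMDiffAt
    ((isOpen_extChartAt_target x).mem_nhds hy))

theorem DiffForm.inChart_pullback {k : ℕ} (α : DiffForm E M k) {p : N → M}
    (hp : ContMDiff 𝓘(ℝ, E) 𝓘(ℝ, E) ∞ p) (x : N) {y : E}
    (hy : y ∈ (extChartAt 𝓘(ℝ, E) x).target) :
    (α.pullback p).inChart x y = α.pullbackModel (p ∘ (extChartAt 𝓘(ℝ, E) x).symm) y := by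
  have h : mfderiv 𝓘(ℝ, E) 𝓘(ℝ, E) (p ∘ (extChartAt 𝓘(ℝ, E) x).symm) y =
      (mfderiv 𝓘(ℝ, E) 𝓘(ℝ, E) p ((extChartAt 𝓘(ℝ, E) x).symm y)).comp
        (mfderiv 𝓘(ℝ, E) 𝓘(ℝ, E) (extChartAt 𝓘(ℝ, E) x).symm y) :=
    mfderiv_comp y (hp.mdifferentiableAt (by simp))
      (((contMDiffOn_extChartAt_symm (n := ∞) x).contMDiffAt
        ((isOpen_extChartAt_target x).mem_nhds hy)).mdifferentiableAt (by simp))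
  unfold DiffForm.pullbackModel DiffForm.pullback DiffForm.inChart
  rw [h]
  rfl

theorem DiffForm.IsSmooth.pullback [IsManifold 𝓘(ℝ, E) ∞ M] {α : DiffForm E M 1} (hα : α.IsSmooth) {p : N → M}
    (hp : ContMDiff 𝓘(ℝ, E) 𝓘(ℝ, E) ∞ p) : (α.pullback p).IsSmooth := by
  intro x
  refine ContDiffOn.congr (fun y hy => ContDiffAt.contDiffWithinAt ?_)
    fun y hy => α.inChart_pullback hp x hy
  exact hα.contDiffAt_pullback (contMDiffAt_comp_extChartAt_symm hp x hy)

/-- The differentials of a chart and of its inverse cancel at the base point. Equalities proved in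
charts are thereby brought back to the manifold. -/
theorem DiffForm.inChart_self {k : ℕ} (β : DiffForm E N k) (x : N) :
    (β.inChart x (extChartAt 𝓘(ℝ, E) x x)).compContinuousLinearMap
      (mfderiv 𝓘(ℝ, E) 𝓘(ℝ, E) (extChartAt 𝓘(ℝ, E) x) x) = β x := by
  have : IsManifold 𝓘(ℝ, E) 1 N := .of_le (n := ∞) (by exact_mod_cast le_top)
  have h2 := mfderivWithin_extChartAt_symm_comp_mfderiv_extChartAt' (I := 𝓘(ℝ, E))
    (mem_extChartAt_source (I := 𝓘(ℝ, E)) x)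
  rw [ModelWithCorners.range_eq_univ, mfderivWithin_univ] at h2
  ext v
  unfold DiffForm.inChart
  have key (u : E) : mfderiv 𝓘(ℝ, E) 𝓘(ℝ, E) (extChartAt 𝓘(ℝ, E) x).symm
      (extChartAt 𝓘(ℝ, E) x x) (mfderiv 𝓘(ℝ, E) 𝓘(ℝ, E) (extChartAt 𝓘(ℝ, E) x) x u) = u :=
    DFunLike.congr_fun h2 u
  have e (w : N) (hw : w = x) (f : Fin k → E) : β w f = β x f := by subst hw; rfl
  refine (e _ (extChartAt_to_inv x) _).trans ?_
  congr 1
  funext i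
  exact key _

theorem DiffForm.IsSmooth.d_pullback [IsManifold 𝓘(ℝ, E) ∞ M] {k : ℕ} {α : DiffForm E M k}
    (hα : α.IsSmooth) {p : N → M} (hp : ContMDiff 𝓘(ℝ, E) 𝓘(ℝ, E) ∞ p) :
    (α.pullback p).d = α.d.pullback p := by
  funext x
  have hx := mem_extChartAt_target (I := 𝓘(ℝ, E)) x
  have he : (α.pullback p).inChart x =ᶠ[𝓝 (extChartAt 𝓘(ℝ, E) x x)]
      α.pullbackModel (p ∘ (extChartAt 𝓘(ℝ, E) x).symm) := by
    filter_upwards [(isOpen_extChartAt_target x).mem_nhds hx] with y hy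
      using α.inChart_pullback hp x hy
  have h1 : extDeriv ((α.pullback p).inChart x) (extChartAt 𝓘(ℝ, E) x x) =
      (α.d.pullback p).inChart x (extChartAt 𝓘(ℝ, E) x x) := by
    rw [he.extDeriv_eq, α.d.inChart_pullback hp x hx]
    exact hα.extDeriv_pullback (contMDiffAt_comp_extChartAt_symm hp x hx)
  rw [← (α.d.pullback p).inChart_self x, ← h1]
  rfl

end Pullback

/-! ### The primitive `θ^i / 2` and its norm -/

section KillingPrimitive

/-- The `1`-form `v ↦ ⟪i x, v⟫ / 2` on `ℝ⁴`, a primitive of `ambientForm`. -/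
def ambientPrimitive : R4 →L[ℝ] R4 [⋀^Fin 1]→L[ℝ] ℝ :=
  (1 / 2 : ℝ) • ambientForm.curryLeft

theorem ambientPrimitive_apply (x : R4) (v : Fin 1 → R4) :
    ambientPrimitive x v = 1 / 2 * ⟪quatField 0 x, v 0⟫_ℝ :=
  rfl

theorem extDeriv_ambientPrimitive (x : R4) : extDeriv ambientPrimitive x = ambientForm := by
  ext v
  -- A linear map is its own derivative; antisymmetrizing an already alternating form doubles it,
  -- which cancels the factor `1 / 2`.
  rw [extDeriv, ContinuousLinearMap.fderiv, ContinuousAlternatingMap.alternatizeUncurryFin_apply,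
    Fin.sum_univ_two]
  have r0 : Fin.removeNth 0 v 0 = v 1 := rfl
  have r1 : Fin.removeNth 1 v 0 = v 0 := rfl
  change _ = ⟪quatField 0 (v 0), v 1⟫_ℝ
  rw [ambientPrimitive_apply, ambientPrimitive_apply, r0, r1]
  simp [inner_R4, quatField]
  ring

theorem half_coframe_apply (x : S3) (v : Fin 1 → TangentSpace (𝓡 3) x) :
    ((1 / 2 : ℝ) • coframe 0) x v = 1 / 2 * ⟪quatField 0 x, dIncl x (v 0)⟫_ℝ :=
  rfl

theorem inChart_half_coframe (x : S3) {y : EuclideanSpace ℝ (Fin 3)}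
    (hy : y ∈ (extChartAt (𝓡 3) x).target) :
    DiffForm.inChart ((1 / 2 : ℝ) • coframe 0) x y =
      (ambientPrimitive (paramS3 x y)).compContinuousLinearMap (fderiv ℝ (paramS3 x) y) := by
  rw [fderiv_paramS3 x hy]
  rfl

theorem half_coframe_smooth : DiffForm.IsSmooth ((1 / 2 : ℝ) • coframe 0) := by
  intro x
  refine ContDiffOn.congr (fun y hy => ?_) fun y hy => inChart_half_coframe x hy
  have hn := (isOpen_extChartAt_target (I := 𝓡 3) x).mem_nhds hy
  have h := (contDiffOn_paramS3 x).contDiffAt hn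
  exact (ContDiffAt.compContinuousLinearMap_one
    (ambientPrimitive.contDiff.contDiffAt.comp y h) (h.fderiv_right (by simp))).contDiffWithinAt

theorem half_coframe_d : DiffForm.d ((1 / 2 : ℝ) • coframe 0) = killingMagneticForm := by
  funext x
  have hx : (extChartAt (𝓡 3) x) x ∈ (extChartAt (𝓡 3) x).target := mem_extChartAt_target x
  have hn := (isOpen_extChartAt_target (I := 𝓡 3) x).mem_nhds hx
  have h : extDeriv (DiffForm.inChart ((1 / 2 : ℝ) • coframe 0) x) ((extChartAt (𝓡 3) x) x) =
      DiffForm.inChart killingMagneticForm x ((extChartAt (𝓡 3) x) x) := by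
    have he : DiffForm.inChart ((1 / 2 : ℝ) • coframe 0) x =ᶠ[nhds ((extChartAt (𝓡 3) x) x)]
        fun y => (ambientPrimitive (paramS3 x y)).compContinuousLinearMap
          (fderiv ℝ (paramS3 x) y) := by
      filter_upwards [hn] with y hy using inChart_half_coframe x hy
    rw [he.extDeriv_eq, inChart_killingMagneticForm x hx]
    have hd : DifferentiableAt ℝ (fun z => ambientPrimitive z)
        (paramS3 x ((extChartAt (𝓡 3) x) x)) := ambientPrimitive.differentiableAt
    have := extDeriv_pullback (x := (extChartAt (𝓡 3) x) x) (f := paramS3 x) hd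
      ((contDiffOn_paramS3 x).contDiffAt hn) (r := ∞)
      (by simp; exact WithTop.coe_le_coe.2 le_top)
    rw [this, extDeriv_ambientPrimitive]
  rw [← DiffForm.inChart_self killingMagneticForm x, ← h]
  rfl

theorem norm_quatField (x : S3) : ‖quatField 0 x‖ = 1 := by
  have h := real_inner_self_eq_norm_sq (x : R4)
  rw [norm_eq_of_mem_sphere, inner_R4] at h
  have h' := real_inner_self_eq_norm_sq (quatField 0 x)
  rw [inner_R4] at h'
  simp [quatField] at h' ⊢
  rw [← sq_eq_sq₀ (norm_nonneg _) zero_le_one, ← h']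
  linarith

theorem abs_half_coframe_le (x : S3) (v : TangentSpace (𝓡 3) x)
    (hv : roundMetric.inner x v v ≤ 1) : |((1 / 2 : ℝ) • coframe 0) x (fun _ => v)| ≤ 1 / 2 := by
  have h1 : ‖dIncl x v‖ ≤ 1 := by
    have hv' : ⟪dIncl x v, dIncl x v⟫_ℝ ≤ 1 := hv
    rw [real_inner_self_eq_norm_sq] at hv'
    nlinarith [norm_nonneg (dIncl x v)]
  have h2 := abs_real_inner_le_norm (quatField 0 x) (dIncl x v)
  rw [norm_quatField, one_mul] at h2
  rw [half_coframe_apply, abs_mul, abs_of_pos (by norm_num : (0 : ℝ) < 1 / 2)]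
  linarith

theorem ofReal_half : ENNReal.ofReal (1 / 2) = 1 / 2 := by
  rw [ENNReal.ofReal_div_of_pos two_pos]
  simp

theorem formNorm_half_coframe (x : S3) :
    formNorm roundMetric id ((1 / 2 : ℝ) • coframe 0) x = 1 / 2 := by
  have hid (v : TangentSpace (𝓡 3) x) :
      mfderiv (𝓡 3) (𝓡 3) (id : S3 → S3) x v = v := by rw [mfderiv_id]; rfl
  rw [← ofReal_half]
  refine le_antisymm (iSup₂_le fun v hv => ENNReal.ofReal_le_ofReal ?_) ?_
  · rw [hid] at hv
    exact abs_half_coframe_le x v hv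
  · have h1 : ⟪quatField 0 x, dIncl x (killingField 0 x)⟫_ℝ = 1 := by
      rw [dIncl_killingField, real_inner_self_eq_norm_sq, norm_quatField, one_pow]
    refine le_iSup₂_of_le (killingField 0 x) ?_ (ENNReal.ofReal_le_ofReal ?_)
    · rw [hid]
      change ⟪dIncl x (killingField 0 x), dIncl x (killingField 0 x)⟫_ℝ ≤ 1
      rw [dIncl_killingField, real_inner_self_eq_norm_sq, norm_quatField, one_pow]
    · rw [half_coframe_apply, h1]
      norm_num

end KillingPrimitive

/-! ### Velocity, action and period of the great circle -/

section HopfCircle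

theorem contMDiff_hopfCircle (s : ℝ) : ContMDiff 𝓘(ℝ, ℝ) (𝓡 3) ∞ (hopfCircle s) := by
  have := Fact.mk (@finrank_euclideanSpace_fin ℝ _ (3 + 1))
  refine ContMDiff.codRestrict_sphere (n := 3)
    (f := fun t : ℝ => (!₂[Real.cos (s * t), Real.sin (s * t), 0, 0] : R4)) ?_
    fun t => (hopfCircle s t).2
  rw [contMDiff_iff_contDiff, contDiff_euclidean]
  intro i
  fin_cases i <;> simp <;> fun_prop

/-- The derivative of the circle in `ℝ⁴` is computed twice, by the chain rule through the inclusion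
and coordinatewise, and derivatives are unique. -/
theorem dIncl_mfderiv_hopfCircle (s t : ℝ) :
    dIncl (hopfCircle s t) (mfderiv 𝓘(ℝ, ℝ) (𝓡 3) (hopfCircle s) t (1 : ℝ)) =
      s • quatField 0 (hopfCircle s t) := by
  obtain ⟨A, h1, hA⟩ : ∃ A : ℝ →L[ℝ] R4, HasFDerivAt (fun t : ℝ => (hopfCircle s t : R4)) A t ∧
      A 1 = dIncl (hopfCircle s t) (mfderiv 𝓘(ℝ, ℝ) (𝓡 3) (hopfCircle s) t (1 : ℝ)) := by
    have := HasMFDerivAt.comp t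
      ((contMDiff_inclS3.mdifferentiableAt (by simp)).hasMFDerivAt
        (x := hopfCircle s t))
      (((contMDiff_hopfCircle s).mdifferentiableAt (by simp)).hasMFDerivAt (x := t))
    exact ⟨_, this.hasFDerivAt, rfl⟩
  have h2 : HasDerivAt (fun t : ℝ => (hopfCircle s t : R4)) (s • quatField 0 (hopfCircle s t)) t := by
    have hs : HasDerivAt (fun t : ℝ => s * t) s t := by simpa using (hasDerivAt_id t).const_mul s
    suffices h : ∀ i, HasDerivAt (fun t : ℝ => (hopfCircle s t : R4) i)
        ((s • quatField 0 (hopfCircle s t)) i) t by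
      rw [← hasDerivWithinAt_univ, hasDerivWithinAt_iff_hasFDerivWithinAt,
        hasFDerivWithinAt_euclidean]
      intro i
      rw [hasFDerivWithinAt_univ]
      refine (h i).hasFDerivAt.congr_fderiv ?_
      ext
      simp
    intro i
    fin_cases i
    · simpa [hopfCircle, quatField, mul_comm] using hs.cos
    · simpa [hopfCircle, quatField, mul_comm] using hs.sin
    · simpa [hopfCircle, quatField] using hasDerivAt_const t (0 : ℝ)
    · simpa [hopfCircle, quatField] using hasDerivAt_const t (0 : ℝ)
  rw [← hA, ← h1.hasDerivAt.unique h2]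

theorem half_coframe_mfderiv_hopfCircle (s t : ℝ) :
    ((1 / 2 : ℝ) • coframe 0) (hopfCircle s t)
      (fun _ => mfderiv 𝓘(ℝ, ℝ) (𝓡 3) (hopfCircle s) t (1 : ℝ)) = s / 2 := by
  rw [half_coframe_apply, dIncl_mfderiv_hopfCircle, inner_smul_right, real_inner_self_eq_norm_sq,
    norm_quatField]
  ring

theorem roundMetric_mfderiv_hopfCircle (s t : ℝ) :
    roundMetric.inner (hopfCircle s t) (mfderiv 𝓘(ℝ, ℝ) (𝓡 3) (hopfCircle s) t (1 : ℝ))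
      (mfderiv 𝓘(ℝ, ℝ) (𝓡 3) (hopfCircle s) t (1 : ℝ)) = s ^ 2 := by
  change ⟪dIncl _ _, dIncl _ _⟫_ℝ = _
  rw [dIncl_mfderiv_hopfCircle, inner_smul_right, inner_smul_left, real_inner_self_eq_norm_sq,
    norm_quatField]
  simp [sq]

theorem magneticAction_hopfCircle (s : ℝ) (hs : s ≠ 0) :
    magneticAction roundMetric ((1 / 2 : ℝ) • coframe 0) s (2 * Real.pi / s) (hopfCircle s) =
      (2 * s - 1) * Real.pi := by
  unfold magneticAction
  -- The integrand is the constant `s² - s / 2`.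
  simp_rw [roundMetric_mfderiv_hopfCircle, half_coframe_mfderiv_hopfCircle]
  rw [intervalIntegral.integral_const, smul_eq_mul]
  field_simp
  ring

theorem hopfCircle_periodic (s : ℝ) (hs : s ≠ 0) :
    Function.Periodic (hopfCircle s) (2 * Real.pi / s) := by
  intro t
  have h : s * (t + 2 * Real.pi / s) = s * t + 2 * Real.pi := by field_simp
  ext i
  fin_cases i <;> simp [hopfCircle, h]

theorem isLeast_period_hopfCircle (s : ℝ) (hs : 0 < s) :
    IsLeast {T : ℝ | 0 < T ∧ Function.Periodic (hopfCircle s) T} (2 * Real.pi / s) := by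
  refine ⟨⟨by positivity, hopfCircle_periodic s hs.ne'⟩, fun T ⟨hT, hp⟩ => ?_⟩
  -- The first coordinate at time 0 already forces `s * T` to be a multiple of `2π`.
  have h0 : Real.cos (s * T) = 1 := by
    have := congrArg (fun x : S3 => (x : R4) 0) (hp 0)
    simpa [hopfCircle] using this
  obtain ⟨k, hk⟩ := (Real.cos_eq_one_iff _).1 h0
  have hk0 : (0 : ℝ) < k := by
    have : 0 < (k : ℝ) * (2 * Real.pi) := hk ▸ mul_pos hs hT
    exact pos_of_mul_pos_left this (by positivity)
  have hk1 : (1 : ℝ) ≤ k := by exact_mod_cast (Int.cast_pos.1 hk0 : 0 < k)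
  rw [div_le_iff₀ hs, mul_comm T, ← hk]
  exact le_mul_of_one_le_left (by positivity) hk1

end HopfCircle

/-! ### Closed 1-forms on a vector space and smooth lifts -/

section LowerBound

variable {E : Type*} [NormedAddCommGroup E] [NormedSpace ℝ E]

/-- The Poincaré lemma for `1`-forms on a vector space. -/
theorem exists_hasFDerivAt_of_extDeriv_eq_zero {β : E → E [⋀^Fin 1]→L[ℝ] ℝ}
    (hβ : Differentiable ℝ β) (hd : ∀ y, extDeriv β y = 0) :
    ∃ f : E → ℝ, ∀ y, ∃ A : E →L[ℝ] ℝ, HasFDerivAt f A y ∧ ∀ v, A v = β y fun _ => v := by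
  let D := ((ContinuousAlternatingMap.ofSubsingletonLIE (𝕜 := ℝ) (E := E) (F := ℝ)
    (0 : Fin 1)).symm : (E [⋀^Fin 1]→L[ℝ] ℝ) →L[ℝ] (E →L[ℝ] ℝ))
  obtain ⟨f, hf⟩ := convex_univ.exists_forall_hasFDerivAt_of_fderiv_symmetric isOpen_univ
    (D.differentiable.comp hβ).differentiableOn fun a _ u v => by
      have h1 : fderiv ℝ (D ∘ β) a = D.comp (fderiv ℝ β a) :=
        (D.hasFDerivAt.comp a (hβ a).hasFDerivAt).fderiv
      -- Closedness evaluated on `(u, v)` is exactly the symmetry of the derivative.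
      have h2 := DFunLike.congr_fun (hd a) ![u, v]
      rw [extDeriv, ContinuousAlternatingMap.alternatizeUncurryFin_apply, Fin.sum_univ_two] at h2
      have r0 : Fin.removeNth 0 ![u, v] = fun _ => v := by ext i; fin_cases i; rfl
      have r1 : Fin.removeNth 1 ![u, v] = fun _ => u := by ext i; fin_cases i; rfl
      rw [r0, r1] at h2
      rw [h1]
      change fderiv ℝ β a u (fun _ => v) = fderiv ℝ β a v (fun _ => u)
      simp at h2
      linarith
  exact ⟨f, fun y => ⟨_, hf y (Set.mem_univ y), fun v => rfl⟩⟩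

/-- Two `1`-forms with the same differential agree somewhere on the velocity of a closed curve. -/
theorem exists_eq_on_velocity {β₁ β₂ : E → E [⋀^Fin 1]→L[ℝ] ℝ} (h₁ : Differentiable ℝ β₁)
    (h₂ : Differentiable ℝ β₂) (hd : ∀ y, extDeriv β₁ y = extDeriv β₂ y) {c c' : ℝ → E} {a b : ℝ}
    (hab : a < b) (hc : ∀ t, HasDerivAt c (c' t) t) (hcl : c a = c b) :
    ∃ t, β₁ (c t) (fun _ => c' t) = β₂ (c t) (fun _ => c' t) := by
  obtain ⟨f, hf⟩ := exists_hasFDerivAt_of_extDeriv_eq_zero (h₁.sub h₂) fun y => by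
    have h : fderiv ℝ (β₁ - β₂) y = fderiv ℝ β₁ y - fderiv ℝ β₂ y := fderiv_sub (h₁ y) (h₂ y)
    rw [extDeriv, h]
    exact ((ContinuousAlternatingMap.alternatizeUncurryFinCLM ℝ E ℝ).map_sub _ _).trans
      (sub_eq_zero.2 (hd y))
  choose A hA hA' using hf
  have hfc (t : ℝ) : HasDerivAt (f ∘ c) (A (c t) (c' t)) t := (hA (c t)).comp_hasDerivAt t (hc t)
  -- Rolle's theorem for `f ∘ c` replaces integration over the loop.
  obtain ⟨t, -, ht⟩ := exists_hasDerivAt_eq_zero (f := f ∘ c) hab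
    (fun t _ => (hfc t).continuousAt.continuousWithinAt) (by simp [hcl]) fun t _ => hfc t
  refine ⟨t, ?_⟩
  rw [hA'] at ht
  exact sub_eq_zero.1 ht

variable {M : Type*} [TopologicalSpace M] [ChartedSpace E M]
  {N : Type*} [TopologicalSpace N] [ChartedSpace E N]

theorem DiffForm.pullback_pullbackModel {k : ℕ} (α : DiffForm E M k) {p : N → M} {F : E → N}
    {y : E} (hp : MDifferentiableAt 𝓘(ℝ, E) 𝓘(ℝ, E) p (F y))
    (hF : MDifferentiableAt 𝓘(ℝ, E) 𝓘(ℝ, E) F y) :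
    (α.pullback p).pullbackModel F y = α.pullbackModel (p ∘ F) y := by
  have h : mfderiv 𝓘(ℝ, E) 𝓘(ℝ, E) (p ∘ F) y =
      (mfderiv 𝓘(ℝ, E) 𝓘(ℝ, E) p (F y)).comp (mfderiv 𝓘(ℝ, E) 𝓘(ℝ, E) F y) :=
    mfderiv_comp y hp hF
  unfold DiffForm.pullbackModel DiffForm.pullback
  rw [h]
  rfl

/-- A continuous lift of a smooth map through a local diffeomorphism is smooth. -/
theorem IsLocalDiffeomorph.contMDiff_of_comp {p : N → M}
    (hp : IsLocalDiffeomorph 𝓘(ℝ, E) 𝓘(ℝ, E) ∞ p) {F : E → N} (hF : Continuous F)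
    (h : ContMDiff 𝓘(ℝ, E) 𝓘(ℝ, E) ∞ (p ∘ F)) : ContMDiff 𝓘(ℝ, E) 𝓘(ℝ, E) ∞ F := by
  intro y
  obtain ⟨Φ, hΦ, he⟩ := hp (F y)
  have ht : p (F y) ∈ Φ.target := by rw [he hΦ]; exact Φ.map_source hΦ
  have h1 : ContMDiffAt 𝓘(ℝ, E) 𝓘(ℝ, E) ∞ Φ.invFun (p (F y)) :=
    Φ.contMDiffOn_invFun.contMDiffAt (Φ.open_target.mem_nhds ht)
  refine (h1.comp y (h y)).congr_of_eventuallyEq ?_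
  filter_upwards [hF.continuousAt (Φ.open_source.mem_nhds hΦ)] with z hz
  change F z = Φ.invFun (p (F z))
  rw [he hz]
  exact (Φ.left_inv hz).symm

end LowerBound

/-! ### The Mañé critical value -/

section Mane

local notation "E3" => EuclideanSpace ℝ (Fin 3)

variable {N : Type*} [TopologicalSpace N] [ChartedSpace E3 N] [IsManifold (𝓡 3) ∞ N] {p : N → S3}

theorem half_le_formNorm_of_lift (hp : ContMDiff (𝓡 3) (𝓡 3) ∞ p) {θ : DiffForm E3 N 1}
    (hθ : θ.IsSmooth) (hd : killingMagneticForm.pullback p = θ.d) {F : E3 → N}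
    (hF : ContMDiff (𝓡 3) (𝓡 3) ∞ F) {c : ℝ → E3} (hc : Differentiable ℝ c)
    (hcl : c 0 = c (2 * Real.pi)) (hpc : (p ∘ F) ∘ c = hopfCircle 1) :
    ∃ x, 1 / 2 ≤ formNorm roundMetric p θ x := by
  have hpF : ContMDiff (𝓡 3) (𝓡 3) ∞ (p ∘ F) := hp.comp hF
  have hpm := hp.mdifferentiable (by simp)
  have hFm := hF.mdifferentiable (by simp)
  obtain ⟨t, ht⟩ := exists_eq_on_velocity (β₁ := θ.pullbackModel F)
    (β₂ := DiffForm.pullbackModel (p ∘ F) ((1 / 2 : ℝ) • coframe 0))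
    (fun y => (hθ.contDiffAt_pullback (hF y)).differentiableAt (by simp))
    (fun y => (half_coframe_smooth.contDiffAt_pullback (hpF y)).differentiableAt (by simp))
    (fun y => by
      rw [hθ.extDeriv_pullback (hF y), half_coframe_smooth.extDeriv_pullback (hpF y), ← hd,
        half_coframe_d]
      exact DiffForm.pullback_pullbackModel _ (hpm _) (hFm _))
    Real.two_pi_pos (fun t => (hc t).hasDerivAt) hcl
  have hv : mfderiv 𝓘(ℝ, ℝ) (𝓡 3) ((p ∘ F) ∘ c) t (1 : ℝ) =
      mfderiv (𝓡 3) (𝓡 3) p (F (c t)) (mfderiv (𝓡 3) (𝓡 3) F (c t) (deriv c t)) := by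
    have h1 := mfderiv_comp t (hpF.mdifferentiable (by simp) (c t)) (hc t).mdifferentiableAt
    have h2 := mfderiv_comp (c t) (hpm (F (c t))) (hFm (c t))
    rw [h1, h2, mfderiv_eq_fderiv]
    rfl
  -- The norm upstairs is measured through the differential of `p`, whereas `θ^i / 2` is pulled back
  -- along `p ∘ F`; the velocity is needed in both factorizations.
  have hv2 : mfderiv 𝓘(ℝ, ℝ) (𝓡 3) ((p ∘ F) ∘ c) t (1 : ℝ) =
      mfderiv (𝓡 3) (𝓡 3) (p ∘ F) (c t) (deriv c t) := by
    have h1 := mfderiv_comp t (hpF.mdifferentiable (by simp) (c t)) (hc t).mdifferentiableAt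
    rw [h1, mfderiv_eq_fderiv]
    rfl
  have hi := roundMetric_mfderiv_hopfCircle 1 t
  have hh := half_coframe_mfderiv_hopfCircle 1 t
  rw [← hpc] at hi hh
  refine ⟨F (c t), ?_⟩
  refine le_iSup₂_of_le (mfderiv (𝓡 3) (𝓡 3) F (c t) (deriv c t)) ?_ ?_
  · rw [hv] at hi
    exact hi.le.trans (by norm_num)
  · rw [hv2] at hh
    have h3 : θ (F (c t)) (fun _ => mfderiv (𝓡 3) (𝓡 3) F (c t) (deriv c t)) = 1 / 2 :=
      ht.trans hh
    rw [h3, abs_of_pos (by norm_num : (0 : ℝ) < 1 / 2), ofReal_half]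

/-- The base point of a chart of `S³` whose domain contains the great circle `hopfCircle`. -/
def chartPoint : S3 := ⟨!₂[0, 0, 1, 0], by simp [EuclideanSpace.norm_eq, Fin.sum_univ_four]⟩

theorem extChartAt_target_S3 (x : S3) : (extChartAt (𝓡 3) x).target = Set.univ := by
  have := Fact.mk (@finrank_euclideanSpace_fin ℝ _ (3 + 1))
  have h : (chartAt E3 x).target = Set.univ := stereographic'_target (n := 3) (-x)
  simp [h]

/-- The chart omits only the antipode of `chartPoint`, whose third coordinate is `-1`, while that of
the circle vanishes. -/
theorem hopfCircle_mem_source (s t : ℝ) :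
    hopfCircle s t ∈ (extChartAt (𝓡 3) chartPoint).source := by
  have := Fact.mk (@finrank_euclideanSpace_fin ℝ _ (3 + 1))
  rw [extChartAt_source]
  have h : (chartAt E3 chartPoint).source = {-chartPoint}ᶜ := stereographic'_source (n := 3) _
  rw [h]
  intro he
  have := congrArg (fun x : S3 => (x : R4) 2) (Set.mem_singleton_iff.1 he)
  simp [hopfCircle, chartPoint] at this

theorem half_le_iSup_formNorm (hp : IsUniversalCovering E3 p) {θ : DiffForm E3 N 1}
    (hθ : θ.IsSmooth) (hd : killingMagneticForm.pullback p = θ.d) :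
    1 / 2 ≤ ⨆ x, formNorm roundMetric p θ x := by
  have hφ : ContMDiff (𝓡 3) (𝓡 3) ∞ (extChartAt (𝓡 3) chartPoint).symm := by
    rw [← contMDiffOn_univ, ← extChartAt_target_S3 chartPoint]
    exact contMDiffOn_extChartAt_symm chartPoint
  obtain ⟨e₀, he₀⟩ := hp.surjective ((extChartAt (𝓡 3) chartPoint).symm 0)
  -- The chart target is all of `E3`, a simply connected space, so the parametrization lifts through
  -- the covering.
  obtain ⟨F, ⟨-, hF⟩, -⟩ := hp.isCoveringMap.existsUnique_continuousMap_lifts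
    ⟨_, hφ.continuous⟩ (0 : E3) e₀ he₀
  replace hF : p ∘ F = (extChartAt (𝓡 3) chartPoint).symm := hF
  have hFs := hp.isLocalDiffeomorph.contMDiff_of_comp F.continuous (hF ▸ hφ)
  have hc : ContDiff ℝ ∞ fun t => extChartAt (𝓡 3) chartPoint (hopfCircle 1 t) := by
    rw [← contMDiff_iff_contDiff]
    intro t
    exact (contMDiffAt_extChartAt' (by simpa using hopfCircle_mem_source 1 t)).comp t
      (contMDiff_hopfCircle 1 t)
  obtain ⟨x, hx⟩ := half_le_formNorm_of_lift hp.isLocalDiffeomorph.contMDiff hθ hd hFs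
    (hc.differentiable (by simp))
    (by
      have h := (hopfCircle_periodic 1 one_ne_zero 0).symm
      rw [zero_add, div_one] at h
      exact congrArg (fun x => extChartAt (𝓡 3) chartPoint x) h)
    (by
      rw [hF]
      funext t
      exact (extChartAt (𝓡 3) chartPoint).left_inv (hopfCircle_mem_source 1 t))
  exact le_iSup_of_le x hx

theorem maneCriticalValue_killingSystem (hp : IsUniversalCovering E3 p) :
    maneCriticalValue killingSystem p = 1 / 2 := by
  have hps := hp.isLocalDiffeomorph.contMDiff
  refine le_antisymm (iInf₂_le_of_le (DiffForm.pullback p ((1 / 2 : ℝ) • coframe 0))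
    ⟨half_coframe_smooth.pullback hps, ?_⟩ (iSup_le fun x => iSup₂_le fun v hv => ?_))
    (le_iInf₂ fun θ h => half_le_iSup_formNorm hp h.1 h.2)
  · rw [half_coframe_smooth.d_pullback hps, half_coframe_d]
    rfl
  · rw [← ofReal_half]
    exact ENNReal.ofReal_le_ofReal (abs_half_coframe_le (p x) _ hv)

end Mane

end

theorem propositionA1 :
    (∀ (N : Type*) [TopologicalSpace N] [ChartedSpace (EuclideanSpace ℝ (Fin 3)) N]
      [IsManifold (𝓡 3) ∞ N] (p : N → S3),
      IsUniversalCovering (EuclideanSpace ℝ (Fin 3)) p →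
        maneCriticalValue killingSystem p = 1 / 2) ∧
    (((1 / 2 : ℝ) • coframe 0).IsSmooth ∧
      ((1 / 2 : ℝ) • coframe 0).d = killingSystem.form ∧
      ∀ x : S3, formNorm roundMetric id ((1 / 2 : ℝ) • coframe 0) x = 1 / 2) ∧
    (∀ s : ℝ, 0 < s → s < 1 / 2 →
      IsLeast {T : ℝ | 0 < T ∧ Function.Periodic (hopfCircle s) T} (2 * Real.pi / s) ∧
      magneticAction roundMetric ((1 / 2 : ℝ) • coframe 0) s (2 * Real.pi / s) (hopfCircle s) =
        (2 * s - 1) * Real.pi ∧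
      (2 * s - 1) * Real.pi < 0) := by
  exact ⟨fun N _ _ _ p hp => maneCriticalValue_killingSystem hp,
    ⟨half_coframe_smooth, half_coframe_d, formNorm_half_coframe⟩,
    fun s hs hs' => ⟨isLeast_period_hopfCircle s hs, magneticAction_hopfCircle s hs.ne',
      mul_neg_of_neg_of_pos (by linarith) Real.pi_pos⟩⟩
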